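/- **D-sets.** A D-set is a set $\Omega$ with a quaternary relation $D(wx;yz)$ such that for all $w,x,y,z\in\Omega$: (D1) $D(wx;yz)$ implies $D(xw;yz)$ and $D(yz;wx)$; (D2) $D(wx;yz)$ implies $\neg D(wy;xz)$; (D3) $D(wx;yz)$ implies that for every $v$, $D(vx;yz)$ or $D(wx;yv)$; (D4) if $w\neq y$ and $x\neq y$ then $D(wx;yy)$. A colored D-set is a D-set together with finitely many unary predicates $P_1,\dots,P_k$ that partition $\Omega$ into nonempty sets. A node splitting of $\Omega$ is a partition of $\Omega$ into more than two nonempty sets, called sectors, such that $D(ab;cd)$ whenever $a,b$ lie in one sector and $c,d$ lie outside of it, and $\neg D(ab;cd)$ whenever $a,b,c,d$ lie in four different sectors. **Sequences.** All sequences are indexed by linear orders without a least and without a greatest element. A sequence $(a_i)_{i\in I}$ of $n$-tuples in a first-order structure $M$ is indiscernible over $B\subseteq M$ if for every formula $\varphi$ with parameters from $B$ and all $i_1<\dots<i_r$, $j_1<\dots<j_r$ in $I$, $M\models\varphi(a_{i_1},\dots,a_{i_r})$ if and only if $M\models\varphi(a_{j_1},\dots,a_{j_r})$; it is indiscernible if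 this holds for $B=\emptyset$. Two sequences of tuples are mutually indiscernible if each of them is indiscernible over the set of all entries of the other. **Hulls.** Let $s=(a_i)_{i\in I}$ be an indiscernible sequence of single elements of a D-set (pure or colored). Then $s$ is either constant; or petaled, i.e. the $a_i$ are distinct and $D$ never holds between four distinct terms; or monotonic, i.e. the $a_i$ are distinct and $D(a_ia_j;a_ka_\ell)$ whenever $i<j<k<\ell$. The discernible hull $H(s)$ is defined as follows. If $s$ is constant, $H(s)=\emptyset$. If $s$ is petaled, there is a unique node splitting $\mathcal C$ of $\Omega$ whose sectors contain at most one $a_i$ each, and $H(s)$ is the union of the sectors of $\mathcal C$ that contain some $a_i$. If $s$ is monotonic, $H(s)$ is the union of $\{a_i: i\in I\}$ and the sets $$H_1(s)=\{x:\ D(a_ia_k;a_jx)\text{ for some } i<j<k\},$$ $$H_2(s)=\{x:\ \text{for some } i<j<k \text{ none of } D(a_ia_j;a_kx),\ D(a_ia_k;a_jx),\ D(a_ja_k;a_ix)\text{ holds}\},$$ $$H_3(s)=\{x:\ D(a_ix;a_ka_\ell)\text{ and }D(a_ia_j;xa_\ell)\text{ for some } i<j<k<\ell\}.$$ For an indiscernible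 sequence $s$ of $n$-tuples, $H(s)$ is the union of the hulls of its $n$ component sequences. **Corollary.** Let $\Omega$ be a D-set or a colored D-set, and let $s$ and $t$ be indiscernible sequences of $n$-tuples and of $m$-tuples in $\Omega$, indexed by linear orders without endpoints (possibly different ones). If $s$ and $t$ are mutually indiscernible, then $H(s)\cap H(t)=\emptyset$. -/

import Mathlib

open FirstOrder

/-! ### D-sets, splittings and sectors -/

/-- The axioms (D1)-(D4) of a D-set for a quaternary relation, `D w x y z` standing for
`D(wx; yz)`. -/
structure IsDSet {Ω : Type*} (D : Ω → Ω → Ω → Ω → Prop) : Prop where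
  d1 : ∀ w x y z, D w x y z → D x w y z ∧ D y z w x
  d2 : ∀ w x y z, D w x y z → ¬ D w y x z
  d3 : ∀ w x y z, D w x y z → ∀ v, D v x y z ∨ D w x y v
  d4 : ∀ w x y, w ≠ y → x ≠ y → D w x y y

/-- A splitting: a partition of `Ω` into at least two (nonempty) sectors, such that
`D(ab; cd)` whenever `a, b` lie in one sector and `c, d` lie outside of it, and `¬ D(ab; cd)`
whenever `a, b, c, d` lie in four different sectors. -/
structure IsSplitting {Ω : Type*} (D : Ω → Ω → Ω → Ω → Prop) (C : Set (Set Ω)) : Prop where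
  isPartition : Setoid.IsPartition C
  two_le : 2 ≤ C.encard
  same : ∀ S ∈ C, ∀ a ∈ S, ∀ b ∈ S, ∀ c ∉ S, ∀ d ∉ S, D a b c d
  diff : ∀ S₁ ∈ C, ∀ S₂ ∈ C, ∀ S₃ ∈ C, ∀ S₄ ∈ C, [S₁, S₂, S₃, S₄].Nodup →
    ∀ a ∈ S₁, ∀ b ∈ S₂, ∀ c ∈ S₃, ∀ d ∈ S₄, ¬ D a b c d

/-- A node splitting: a splitting into more than two sectors. -/
def IsNodeSplitting {Ω : Type*} (D : Ω → Ω → Ω → Ω → Prop) (C : Set (Set Ω)) : Prop :=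
  IsSplitting D C ∧ 2 < C.encard

/-! ### Sequences of singletons and their discernible hulls -/

/-- All terms of the sequence are equal. -/
def IsConstantSeq {Ω I : Type*} (a : I → Ω) : Prop :=
  ∀ i j, a i = a j

/-- The terms are distinct, and there is no `D`-relation between four distinct terms. -/
def IsPetaled {Ω I : Type*} (D : Ω → Ω → Ω → Ω → Prop) (a : I → Ω) : Prop :=
  Function.Injective a ∧ ∀ i j k l, [i, j, k, l].Nodup → ¬ D (a i) (a j) (a k) (a l)

/-- The terms are distinct, and `D(a_i a_j; a_k a_l)` whenever `i < j < k < l`. -/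
def IsMonotonic {Ω I : Type*} [LinearOrder I] (D : Ω → Ω → Ω → Ω → Prop) (a : I → Ω) : Prop :=
  Function.Injective a ∧ ∀ i j k l, i < j → j < k → k < l → D (a i) (a j) (a k) (a l)

/-- `C` is a node splitting of `Ω` extending `{{a_i} : i ∈ I}`: it separates the terms of `a`. -/
def IsNodeSplittingSeparating {Ω I : Type*} (D : Ω → Ω → Ω → Ω → Prop) (a : I → Ω)
    (C : Set (Set Ω)) : Prop :=
  IsNodeSplitting D C ∧ ∀ S ∈ C, ∀ i j, a i ∈ S → a j ∈ S → a i = a j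

/-- `x` and `y` lie in the same sector of the node splitting that separates `p, q, r`. -/
def SameSector {Ω : Type*} (D : Ω → Ω → Ω → Ω → Prop) (p q r x y : Ω) : Prop :=
  D x y p q ∨ D x y p r ∨ D x y q r

theorem IsDSet.transitivity {Ω : Type*} {D : Ω → Ω → Ω → Ω → Prop} (hD : IsDSet D)
    {a b x y z : Ω} (h : D a b x y) (h' : D a b y z) : D a b x z := by
  obtain ⟨d1, d2, d3, -⟩ := hD
  grind

theorem IsDSet.sameSector_aux {Ω : Type*} {D : Ω → Ω → Ω → Ω → Prop} (hD : IsDSet D)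
    {p q r x y z : Ω} (h : D x y p q) (h' : D y z p r) :
    D x z p q ∨ D x z p r ∨ D x z q r := by
  obtain ⟨d1, d2, d3, -⟩ := hD
  grind

theorem IsDSet.sameSector_equivalence {Ω : Type*} {D : Ω → Ω → Ω → Ω → Prop} (hD : IsDSet D)
    {p q r : Ω} (hpq : p ≠ q) (hpr : p ≠ r) (hqr : q ≠ r) :
    Equivalence (SameSector D p q r) := by
  have d1 := hD.d1
  have d4 := hD.d4
  have sym : ∀ w x y z, D w x y z → D w x z y := fun w x y z h => by
    exact (d1 _ _ _ _ ((d1 _ _ _ _ ((d1 _ _ _ _ h).2)).1)).2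
  refine ⟨fun x => ?_, fun {x y} h => ?_, fun {x y z} h h' => ?_⟩
  · have key : ∀ u v, u ≠ x → v ≠ x → D x x u v := fun u v hu hv =>
      (d1 _ _ _ _ (d4 u v x hu hv)).2
    unfold SameSector
    by_cases hp : p = x
    · exact Or.inr (Or.inr (key q r (fun e => hpq (hp.trans e.symm)) fun e => hpr (hp.trans e.symm)))
    · by_cases hq : q = x
      · exact Or.inr (Or.inl (key p r hp fun e => hqr (hq.trans e.symm)))
      · exact Or.inl (key p q hp hq)
  · exact h.imp (fun h => (d1 _ _ _ _ h).1)
      (Or.imp (fun h => (d1 _ _ _ _ h).1) (fun h => (d1 _ _ _ _ h).1))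
  · have tr : ∀ u v, D x y u v → D y z u v → D x z u v := fun u v h h' =>
      (d1 _ _ _ _ (hD.transitivity (d1 _ _ _ _ h).2 (d1 _ _ _ _ h').2)).2
    have aux := fun u v w => hD.sameSector_aux (p := u) (q := v) (r := w) (x := x) (y := y) (z := z)
    have s := sym x y
    have s' := sym y z
    have s'' := sym x z
    unfold SameSector at *
    rcases h with h | h | h <;> rcases h' with h' | h' | h'
    · exact Or.inl (tr _ _ h h')
    · exact aux _ _ _ h h'
    · rcases aux _ _ _ (s _ _ h) h' with k | k | k <;> simp [k, s'' _ _ k]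
    · rcases aux _ _ _ h h' with k | k | k <;> simp [k, s'' _ _ k]
    · exact Or.inr (Or.inl (tr _ _ h h'))
    · rcases aux _ _ _ (s _ _ h) (s' _ _ h') with k | k | k <;> simp [k, s'' _ _ k]
    · rcases aux _ _ _ h (s' _ _ h') with k | k | k <;> simp [k, s'' _ _ k]
    · rcases aux _ _ _ (s _ _ h) (s' _ _ h') with k | k | k <;> simp [s'' _ _ k]
    · exact Or.inr (Or.inr (tr _ _ h h'))

/-- Replace a parameter of the splitting by a point of another sector. -/
theorem IsDSet.sameSector_or {Ω : Type*} {D : Ω → Ω → Ω → Ω → Prop} (hD : IsDSet D)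
    {p q a b c : Ω} (hab : D a b p q) : D a b p c ∨ D a c p q := by
  obtain ⟨d1, d2, d3, d4⟩ := hD
  grind

theorem IsDSet.sameSector_same {Ω : Type*} {D : Ω → Ω → Ω → Ω → Prop} (hD : IsDSet D)
    {p q r : Ω} {a b c d : Ω}
    (hab : SameSector D p q r a b) (hac : ¬ SameSector D p q r a c)
    (had : ¬ SameSector D p q r a d) : D a b c d := by
  have d1 := hD.d1
  have key : ∀ u v, D a b u v → ¬ D a c u v → ¬ D a d u v → D a b c d := by
    intro u v h hc hd
    have h1 := (hD.sameSector_or (c := c) h).resolve_right hc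
    have h2 := (hD.sameSector_or (c := d) h).resolve_right hd
    have e := d1 _ _ _ _ ((d1 _ _ _ _ ((d1 _ _ _ _ h1).2)).1)
    exact hD.transitivity e.2 h2
  unfold SameSector at *
  push Not at hac had
  rcases hab with h | h | h
  · exact key _ _ h hac.1 had.1
  · exact key _ _ h hac.2.1 had.2.1
  · exact key _ _ h hac.2.2 had.2.2

theorem IsDSet.sameSector_diff {Ω : Type*} {D : Ω → Ω → Ω → Ω → Prop} (hD : IsDSet D)
    {p q r : Ω} {a b c d : Ω} (hab : ¬ SameSector D p q r a b)
    (hcd : ¬ SameSector D p q r c d) : ¬ D a b c d := by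
  intro h
  have d1 := hD.d1
  have sym : ∀ {w x y z}, D w x y z → D w x z y := fun {w x y z} h =>
    (d1 _ _ _ _ ((d1 _ _ _ _ ((d1 _ _ _ _ h).2)).1)).2
  have key : ∀ u, D a b c u ∨ D c d a u := fun u =>
    (hD.d3 _ _ _ _ h u).elim
      (fun k => Or.inr (hD.transitivity (d1 _ _ _ _ h).2 (sym (d1 _ _ _ _ k).2))) Or.inl
  have tr : ∀ {x y z u v}, D x y z u → D x y z v → D x y u v := fun h h' =>
    hD.transitivity (sym h) h'
  unfold SameSector at *
  push Not at hab hcd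
  rcases key p with hp | hp <;> rcases key q with hq | hq <;> rcases key r with hr | hr
  · exact hab.1 (tr hp hq)
  · exact hab.1 (tr hp hq)
  · exact hab.2.1 (tr hp hr)
  · exact hcd.2.2 (tr hq hr)
  · exact hab.2.2 (tr hq hr)
  · exact hcd.2.1 (tr hp hr)
  · exact hcd.1 (tr hp hq)
  · exact hcd.1 (tr hp hq)

/-- A node splitting separating `p, q, r` is the partition into classes of `SameSector`. -/
theorem IsSplitting.mem_iff_sameSector {Ω : Type*} {D : Ω → Ω → Ω → Ω → Prop} (hD : IsDSet D)
    {C : Set (Set Ω)} (hC : IsSplitting D C) {p q r : Ω} {P Q R : Set Ω} (hP : P ∈ C)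
    (hQ : Q ∈ C) (hR : R ∈ C) (hp : p ∈ P) (hq : q ∈ Q) (hr : r ∈ R) (hPQ : P ≠ Q) (hPR : P ≠ R)
    (hQR : Q ≠ R) {x y : Ω} {S : Set Ω} (hS : S ∈ C) (hx : x ∈ S) :
    y ∈ S ↔ SameSector D p q r x y := by
  have uniq : ∀ {A B : Set Ω} {z : Ω}, A ∈ C → B ∈ C → z ∈ A → z ∈ B → A = B :=
    fun {A B z} hA hB hzA hzB => (hC.isPartition.2 z).unique ⟨hA, hzA⟩ ⟨hB, hzB⟩
  constructor
  · intro hy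
    have key : ∀ u v, u ∉ S → v ∉ S → D x y u v := fun u v hu hv =>
      hC.same S hS x hx y hy u hu v hv
    unfold SameSector
    by_cases h1 : p ∈ S
    · exact Or.inr (Or.inr (key _ _ (fun h => hPQ (uniq hP hS hp h1 ▸ uniq hS hQ h hq))
        fun h => hPR (uniq hP hS hp h1 ▸ uniq hS hR h hr)))
    · by_cases h2 : q ∈ S
      · exact Or.inr (Or.inl (key _ _ h1 fun h => hQR (uniq hQ hS hq h2 ▸ uniq hS hR h hr)))
      · exact Or.inl (key _ _ h1 h2)
  · intro h
    by_contra hy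
    obtain ⟨T, ⟨hT, hyT⟩, -⟩ := hC.isPartition.2 y
    have hST : S ≠ T := fun e => hy (e ▸ hyT)
    have key : ∀ {U V : Set Ω} {u v : Ω}, U ∈ C → V ∈ C → u ∈ U → v ∈ V → U ≠ V →
        ¬ D x y u v := by
      intro U V u v hU hV hu hv hUV hxy
      have hd1 := hD.d1
      have hd2 := hD.d2
      have out : ∀ {A B : Set Ω} {z : Ω}, A ∈ C → B ∈ C → A ≠ B → z ∈ A → z ∉ B :=
        fun hA hB hAB hzA hzB => hAB (uniq hA hB hzA hzB)
      by_cases e1 : S = U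
      · subst e1
        have := hC.same S hS x hx u hu y hy v (out hV hS hUV.symm hv)
        exact hd2 _ _ _ _ hxy this
      by_cases e2 : S = V
      · subst e2
        have := hC.same S hS x hx v hv y hy u (out hU hS hUV hu)
        exact hd2 _ _ _ _ (hd1 _ _ _ _ (hd1 _ _ _ _ (hd1 _ _ _ _ hxy).2).1).2 this
      by_cases e3 : T = U
      · subst e3
        have := hC.same T hT y hyT u hu x (out hS hT hST hx) v (out hV hT hUV.symm hv)
        exact hd2 _ _ _ _ (hd1 _ _ _ _ hxy).1 this
      by_cases e4 : T = V
      · subst e4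
        have := hC.same T hT y hyT v hv x (out hS hT hST hx) u (out hU hT hUV hu)
        exact hd2 _ _ _ _ (hd1 _ _ _ _ (hd1 _ _ _ _ (hd1 _ _ _ _
          (hd1 _ _ _ _ hxy).1).2).1).2 this
      exact hC.diff S hS T hT U hU V hV (by simp [*]) x hx y hyT u hu v hv hxy
    rcases h with h | h | h
    · exact key hP hQ hp hq hPQ h
    · exact key hP hR hp hr hPR h
    · exact key hQ hR hq hr hQR h

/-- A petaled sequence with at least three terms has a unique extension to a node splitting. -/
theorem existsUnique_isNodeSplittingSeparating {Ω I : Type*} {D : Ω → Ω → Ω → Ω → Prop}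
    (hD : IsDSet D) {a : I → Ω} (ha : IsPetaled D a) {i₀ i₁ i₂ : I} (h₀₁ : i₀ ≠ i₁)
    (h₀₂ : i₀ ≠ i₂) (h₁₂ : i₁ ≠ i₂) : ∃! C, IsNodeSplittingSeparating D a C := by
  have hpq : a i₀ ≠ a i₁ := ha.1.ne h₀₁
  have hpr : a i₀ ≠ a i₂ := ha.1.ne h₀₂
  have hqr : a i₁ ≠ a i₂ := ha.1.ne h₁₂
  have hE := hD.sameSector_equivalence hpq hpr hqr
  have d1 := hD.d1
  have d2 := hD.d2
  have d4 := hD.d4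
  let r : Setoid Ω := ⟨_, hE⟩
  have hsep : ∀ i j, SameSector D (a i₀) (a i₁) (a i₂) (a i) (a j) → i = j := by
    intro i j h
    by_contra hij
    have hij' := ha.1.ne hij
    have key : ∀ u v, u ≠ v → ¬ D (a i) (a j) (a u) (a v) := by
      intro u v huv h
      have huv' := ha.1.ne huv
      have := ha.2 i j u v
      have h2 := d2 _ _ _ _ h
      simp only [List.nodup_cons, List.mem_cons, List.not_mem_nil, not_or, or_false,
        not_false_iff, List.nodup_nil, and_true] at this
      grind
    rcases h with h | h | h
    · exact key _ _ h₀₁ h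
    · exact key _ _ h₀₂ h
    · exact key _ _ h₁₂ h
  have three : ∀ {C : Set (Set Ω)} {P Q R : Set Ω}, P ∈ C → Q ∈ C → R ∈ C → P ≠ Q → P ≠ R →
      Q ≠ R → 2 < C.encard := by
    intro C P Q R hP hQ hR h1 h2 h3
    have h4 : ({P, Q, R} : Set (Set Ω)) ⊆ C := by
      rintro x (rfl | rfl | rfl) <;> assumption
    refine lt_of_lt_of_le ?_ (Set.encard_le_encard h4)
    rw [Set.encard_eq_three.2 ⟨P, Q, R, h1, h2, h3, rfl⟩]
    decide
  have hmem : ∀ S ∈ r.classes, ∀ x ∈ S, ∀ y, y ∈ S ↔ SameSector D (a i₀) (a i₁) (a i₂) x y := by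
    rintro S ⟨z, rfl⟩ x hx y
    exact ⟨fun hy => hE.trans hx (hE.symm hy), fun hy => hE.trans (hE.symm hy) hx⟩
  have hne : ∀ i j, i ≠ j → {x | r x (a i)} ≠ {x | r x (a j)} := by
    intro i j hij e
    have : a i ∈ {x | r x (a j)} := e ▸ (hE.refl (a i) : a i ∈ {x | r x (a i)})
    exact hij (hsep i j this)
  have h2 : 2 < r.classes.encard := three (r.mem_classes (a i₀)) (r.mem_classes (a i₁))
    (r.mem_classes (a i₂)) (hne _ _ h₀₁) (hne _ _ h₀₂) (hne _ _ h₁₂)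
  refine ⟨r.classes, ⟨⟨⟨r.isPartition_classes, h2.le, ?_, ?_⟩, h2⟩, ?_⟩, ?_⟩
  · intro S hS x hx y hy c hc d hd
    exact hD.sameSector_same ((hmem S hS x hx y).1 hy) (fun h => hc ((hmem S hS x hx c).2 h))
      fun h => hd ((hmem S hS x hx d).2 h)
  · intro S₁ h₁ S₂ h₂ S₃ h₃ S₄ h₄ hn x hx y hy z hz w hw
    have hn' : S₁ ≠ S₂ ∧ S₃ ≠ S₄ := by
      simp only [List.nodup_cons, List.mem_cons, not_or] at hn
      exact ⟨hn.1.1, hn.2.2.1.1⟩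
    have uniq : ∀ {A B : Set Ω} {z : Ω}, A ∈ r.classes → B ∈ r.classes → z ∈ A → z ∈ B → A = B :=
      fun {A B z} hA hB hzA hzB => (r.isPartition_classes.2 z).unique ⟨hA, hzA⟩ ⟨hB, hzB⟩
    exact hD.sameSector_diff
      (fun h => hn'.1 (uniq h₁ h₂ ((hmem S₁ h₁ x hx y).2 h) hy))
      (fun h => hn'.2 (uniq h₃ h₄ ((hmem S₃ h₃ z hz w).2 h) hw))
  · intro S hS i j hi hj
    rw [hsep i j ((hmem S hS _ hi _).1 hj)]
  · rintro C ⟨⟨hC, -⟩, hs⟩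
    obtain ⟨P, ⟨hP, hp⟩, -⟩ := hC.isPartition.2 (a i₀)
    obtain ⟨Q, ⟨hQ, hq⟩, -⟩ := hC.isPartition.2 (a i₁)
    obtain ⟨R, ⟨hR, hr⟩, -⟩ := hC.isPartition.2 (a i₂)
    have hPQ : P ≠ Q := fun e => hpq (hs P hP _ _ hp (e ▸ hq))
    have hPR : P ≠ R := fun e => hpr (hs P hP _ _ hp (e ▸ hr))
    have hQR : Q ≠ R := fun e => hqr (hs Q hQ _ _ hq (e ▸ hr))
    have hm : ∀ S ∈ C, ∀ x ∈ S, S = {y | r y x} := fun S hS x hx => Set.ext fun y =>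
      (hC.mem_iff_sameSector hD hP hQ hR hp hq hr hPQ hPR hQR hS hx).trans
        ⟨fun h => hE.symm h, fun h => hE.symm h⟩
    ext S
    constructor
    · intro hS
      obtain ⟨x, hx⟩ := Set.nonempty_iff_ne_empty.2 fun e => hC.isPartition.1 (e ▸ hS)
      exact ⟨x, hm S hS x hx⟩
    · rintro ⟨x, rfl⟩
      obtain ⟨S, ⟨hS, hx⟩, -⟩ := hC.isPartition.2 x
      exact hm S hS x hx ▸ hS

/-- The hull of a petaled sequence: the union of the sectors containing a term of `a`, in the
node splitting that extends `{{a_i} : i ∈ I}`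
(it exists and is unique, see `existsUnique_isNodeSplittingSeparating`). -/
def petaledHull {Ω I : Type*} (D : Ω → Ω → Ω → Ω → Prop) (a : I → Ω) : Set Ω :=
  {x | ∃ C, IsNodeSplittingSeparating D a C ∧ ∃ S ∈ C, x ∈ S ∧ ∃ i, a i ∈ S}

/-- `H₁`: there are `i < j < k` with `D(a_i a_k; a_j x)`. -/
def monotonicHull₁ {Ω I : Type*} [LinearOrder I] (D : Ω → Ω → Ω → Ω → Prop) (a : I → Ω) :
    Set Ω :=
  {x | ∃ i j k, i < j ∧ j < k ∧ D (a i) (a k) (a j) x}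

/-- `H₂`: there are `i < j < k` such that no `D`-relation holds on `{a_i, a_j, a_k, x}`
(up to the symmetries of `D` there are three possible relations). -/
def monotonicHull₂ {Ω I : Type*} [LinearOrder I] (D : Ω → Ω → Ω → Ω → Prop) (a : I → Ω) :
    Set Ω :=
  {x | ∃ i j k, i < j ∧ j < k ∧
    ¬ D (a i) (a j) (a k) x ∧ ¬ D (a i) (a k) (a j) x ∧ ¬ D (a j) (a k) (a i) x}

/-- `H₃`: there are `i < j < k < l` with `D(a_i x; a_k a_l)` and `D(a_i a_j; x a_l)`. -/
def monotonicHull₃ {Ω I : Type*} [LinearOrder I] (D : Ω → Ω → Ω → Ω → Prop) (a : I → Ω) :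
    Set Ω :=
  {x | ∃ i j k l, i < j ∧ j < k ∧ k < l ∧ D (a i) x (a k) (a l) ∧ D (a i) (a j) x (a l)}

open Classical in
/-- The discernible hull of a sequence of singletons. (An unbounded indiscernible sequence of
singletons in a D-set is constant, petaled or monotonic; the last value is a dummy.) -/
noncomputable def discernibleHull₁ {Ω I : Type*} [LinearOrder I] (D : Ω → Ω → Ω → Ω → Prop)
    (a : I → Ω) : Set Ω :=
  if IsConstantSeq a then ∅
  else if IsPetaled D a then petaledHull D a
  else if IsMonotonic D a then
    Set.range a ∪ monotonicHull₁ D a ∪ monotonicHull₂ D a ∪ monotonicHull₃ D a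
  else ∅

/-- The discernible hull of a sequence of `n`-tuples: the union of the hulls of its component
sequences. -/
noncomputable def discernibleHull {Ω I : Type*} [LinearOrder I] {n : ℕ}
    (D : Ω → Ω → Ω → Ω → Prop) (s : I → Fin n → Ω) : Set Ω :=
  ⋃ p : Fin n, discernibleHull₁ D (fun i => s i p)

/-! ### Indiscernible sequences -/

/-- The sequence `s` of `n`-tuples in the `L`-structure `M` is (order) indiscernible over `B`:
every formula with parameters in `B` takes the same truth value at `(s_{i_1}, …, s_{i_m})` and
`(s_{j_1}, …, s_{j_m})`, for all `i_1 < ⋯ < i_m` and `j_1 < ⋯ < j_m`. -/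
def IsIndiscernibleOver (L : Language) {M : Type*} [L.Structure M] (B : Set M)
    {I : Type*} [LinearOrder I] {n : ℕ} (s : I → Fin n → M) : Prop :=
  ∀ (m : ℕ) (φ : (L[[B]]).Formula (Fin m × Fin n)) (i j : Fin m → I),
    StrictMono i → StrictMono j →
      (φ.Realize (fun p => s (i p.1) p.2) ↔ φ.Realize (fun p => s (j p.1) p.2))

/-- Indiscernible, that is, indiscernible over `∅`. -/
def IsIndiscernible (L : Language) {M : Type*} [L.Structure M]
    {I : Type*} [LinearOrder I] {n : ℕ} (s : I → Fin n → M) : Prop :=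
  IsIndiscernibleOver L (∅ : Set M) s

/-- The set of all entries of all terms of a sequence of tuples. -/
def entries {M I : Type*} {n : ℕ} (s : I → Fin n → M) : Set M :=
  {x | ∃ i p, s i p = x}

/-- Each of the two sequences is indiscernible over the other. -/
def AreMutuallyIndiscernible (L : Language) {M : Type*} [L.Structure M]
    {I J : Type*} [LinearOrder I] [LinearOrder J] {n m : ℕ}
    (s : I → Fin n → M) (t : J → Fin m → M) : Prop :=
  IsIndiscernibleOver L (entries t) s ∧ IsIndiscernibleOver L (entries s) t

/-! ### D-sets and colored D-sets as first-order structures -/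

/-- The relation symbols of the language of D-sets with `k` colors: a quaternary symbol for `D`
and unary symbols for the colors. -/
inductive DRelSymbol (k : ℕ) : ℕ → Type
  | rel : DRelSymbol k 4
  | color (c : Fin k) : DRelSymbol k 1

/-- The language of D-sets with `k` colors; for `k = 0` it is the language `{D}`. -/
def dLanguage (k : ℕ) : Language :=
  ⟨fun _ => Empty, DRelSymbol k⟩

/-- The interpretation of `D`. -/
def dRel (k : ℕ) (Ω : Type*) [(dLanguage k).Structure Ω] (w x y z : Ω) : Prop :=
  Language.Structure.RelMap (L := dLanguage k) (DRelSymbol.rel (k := k)) ![w, x, y, z]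

/-- The interpretation of the `c`-th color. -/
def colorSet (k : ℕ) (Ω : Type*) [(dLanguage k).Structure Ω] (c : Fin k) : Set Ω :=
  {x | Language.Structure.RelMap (L := dLanguage k) (DRelSymbol.color c) ![x]}

/-- The `k` sets form a partition of `Ω` into nonempty sets. -/
def IsColoring {k : ℕ} {Ω : Type*} (P : Fin k → Set Ω) : Prop :=
  (∀ c, (P c).Nonempty) ∧ (∀ c d, c ≠ d → Disjoint (P c) (P d)) ∧ ⋃ c, P c = Set.univ

/-- A D-set, either pure (no colors) or colored by `k` colors. -/
def IsPureOrColoredDSet (k : ℕ) (Ω : Type*) [(dLanguage k).Structure Ω] : Prop :=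
  IsDSet (dRel k Ω) ∧ (k = 0 ∨ IsColoring (colorSet k Ω))

/-! ### Consequences of indiscernibility for the relation `D` -/

/-! Read `D` as the branching relation of a tree whose leaves are the points of `Ω`. The hull is a
union of component hulls, so two sequences `a`, `b` of single elements suffice, and of mutual
indiscernibility only `IsDUniformOver`, in both directions, is needed.

A point `x` of the hull of `a` is tied to `a` rather than to `b`: there are `i ≠ k` with `D(a_i x;
a_k b_j)` for all `j` (the two `exists_rel_of_mem` lemmas). Uniformity forces this by keeping `b`
out of the interior of `a`: a term of `b` lies in no petal of a petaled `a` (`IsPetaled.not_rel`),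
and all of `b` lies beyond one end of a monotonic `a` (`IsMonotonic.rel`).

A common point of both hulls would be tied to both sequences, which the axioms exclude: by
`IsDSet.not_rel_of_separated` when pairs from `a` split off from pairs from `b`, as is automatic if
one sequence is monotonic, and by a direct argument in the remaining petaled case. -/

/-- The truth value of `D` at four terms of `a` and `b` depends only on the terms of `b` and on the
relative order of the indices of the terms of `a`. -/
def IsDUniformOver {Ω I J : Type*} [LinearOrder I] (D : Ω → Ω → Ω → Ω → Prop) (a : I → Ω)
    (b : J → Ω) : Prop :=
  ∀ (r : ℕ) (v₀ v₁ v₂ v₃ : Fin r ⊕ J) (i j : Fin r → I), StrictMono i → StrictMono j →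
    (D (Sum.elim (a ∘ i) b v₀) (Sum.elim (a ∘ i) b v₁) (Sum.elim (a ∘ i) b v₂)
        (Sum.elim (a ∘ i) b v₃) ↔
      D (Sum.elim (a ∘ j) b v₀) (Sum.elim (a ∘ j) b v₁) (Sum.elim (a ∘ j) b v₂)
        (Sum.elim (a ∘ j) b v₃))

/-- One atomic formula suffices, with constants naming the terms of `t`. Indiscernibility is used
for no other formula, so the colors play no role. -/
theorem IsIndiscernibleOver.isDUniformOver {k : ℕ} {Ω : Type*} [(dLanguage k).Structure Ω]
    {I J : Type*} [LinearOrder I] {n m : ℕ} {s : I → Fin n → Ω} {t : J → Fin m → Ω}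
    (h : IsIndiscernibleOver (dLanguage k) (entries t) s) (p : Fin n) (q : Fin m) :
    IsDUniformOver (dRel k Ω) (fun i => s i p) (fun j => t j q) := by
  intro r v₀ v₁ v₂ v₃ i j hi hj
  let c : J → entries t := fun l => ⟨t l q, l, q, rfl⟩
  let T : Fin r ⊕ J → ((dLanguage k)[[entries t]]).Term (Fin r × Fin n) :=
    Sum.elim (fun l => Language.Term.var (l, p))
      (fun l => Language.Constants.term ((dLanguage k).con (c l)))
  have hT : ∀ (i : Fin r → I) (v : Fin r ⊕ J),
      (T v).realize (fun x => s (i x.1) x.2) =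
        Sum.elim ((fun i => s i p) ∘ i) (fun j => t j q) v := by
    rintro i (v | v)
    · rfl
    · simp [T, c]
  let R : (dLanguage k).Relations 4 := DRelSymbol.rel
  let φ : ((dLanguage k)[[entries t]]).Formula (Fin r × Fin n) :=
    (((dLanguage k).lhomWithConstants (entries t)).onRelation R).formula ![T v₀, T v₁, T v₂, T v₃]
  have hR : ∀ i : Fin r → I, φ.Realize (fun x => s (i x.1) x.2) ↔
      dRel k Ω (Sum.elim ((fun i => s i p) ∘ i) (fun j => t j q) v₀)
        (Sum.elim ((fun i => s i p) ∘ i) (fun j => t j q) v₁)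
        (Sum.elim ((fun i => s i p) ∘ i) (fun j => t j q) v₂)
        (Sum.elim ((fun i => s i p) ∘ i) (fun j => t j q) v₃) := by
    intro i
    refine Language.Formula.realize_rel.trans ?_
    rw [Language.LHom.map_onRelation, ← hT, ← hT, ← hT, ← hT]
    refine iff_of_eq (congrArg _ (funext fun x => ?_))
    fin_cases x <;> rfl
  have key := h r φ i j hi hj
  rwa [hR, hR] at key

namespace IsDUniformOver

variable {Ω I J : Type*} [LinearOrder I] {D : Ω → Ω → Ω → Ω → Prop} {a : I → Ω} {b : J → Ω}

theorem one (h : IsDUniformOver D a b) (j k l : J) (i i' : I) :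
    D (b j) (b k) (b l) (a i) ↔ D (b j) (b k) (b l) (a i') :=
  h 1 (.inr j) (.inr k) (.inr l) (.inl 0) ![i] ![i'] (Subsingleton.strictMono _)
    (Subsingleton.strictMono _)

theorem two (h : IsDUniformOver D a b) (j j' : J) {i k i' k' : I} (hik : i < k) (hik' : i' < k') :
    D (a i) (a k) (b j) (b j') ↔ D (a i') (a k') (b j) (b j') :=
  h 2 (.inl 0) (.inl 1) (.inr j) (.inr j') ![i, k] ![i', k'] (by simpa) (by simpa)

/-- Up to symmetry these are the only relations among three terms of `a` and one of `b`: all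
increasing triples see `b j` in the same way. -/
theorem three (h : IsDUniformOver D a b) (j : J) {i k l i' k' l' : I}
    (hik : i < k) (hkl : k < l) (hik' : i' < k') (hkl' : k' < l') :
    (D (a i) (a k) (a l) (b j) ↔ D (a i') (a k') (a l') (b j)) ∧
      (D (a i) (a l) (a k) (b j) ↔ D (a i') (a l') (a k') (b j)) ∧
      (D (a k) (a l) (a i) (b j) ↔ D (a k') (a l') (a i') (b j)) := by
  have key := fun x y z : Fin 3 => h 3 (.inl x) (.inl y) (.inl z) (.inr j) ![i, k, l] ![i', k', l']
    (by simp [hik, hkl]) (by simp [hik', hkl'])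
  exact ⟨key 0 1 2, key 0 2 1, key 1 2 0⟩

end IsDUniformOver

/-! ### Terms of one sequence relative to the hull of the other -/

theorem exists_lt_lt_lt {I : Type*} [LinearOrder I] [NoMaxOrder I] (i : I) :
    ∃ j k l : I, i < j ∧ j < k ∧ k < l := by
  obtain ⟨j, hj⟩ := exists_gt i
  obtain ⟨k, hk⟩ := exists_gt j
  obtain ⟨l, hl⟩ := exists_gt k
  exact ⟨j, k, l, hj, hk, hl⟩

section

variable {Ω I J : Type*} [LinearOrder I] [NoMaxOrder I]
  {D : Ω → Ω → Ω → Ω → Prop} {a : I → Ω} {b : J → Ω}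

/-! ### Petaled sequences -/

/-- The terms of `b` lie outside of the petals containing the terms of `a`. -/
theorem IsPetaled.not_rel (hD : IsDSet D) (ha : IsPetaled D a) (hab : IsDUniformOver D a b)
    {i k l : I} (hik : i ≠ k) (hil : i ≠ l) (hkl : k ≠ l) (j : J) :
    ¬ D (a i) (b j) (a k) (a l) := by
  obtain ⟨i₂, i₃, i₄, h₁, h₂, h₃⟩ := exists_lt_lt_lt i
  have d1 := hD.d1
  -- If `b_j` is paired with both `a_u` and `a_v` against `a_w, a_z`, transitivity gives `D(a_u a_v;
  -- a_w a_z)`. Uniformity turns one pairing into two once `u` and `v` have the same position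
  -- relative to `w, z`; `k₁`, `k₂`, `k₃` treat the lowest, middle and highest position.
  have key : ∀ u v w z, [u, v, w, z].Nodup → D (a w) (a z) (a u) (b j) →
      ¬ D (a w) (a z) (a v) (b j) := by
    intro u v w z hn hu hv
    refine ha.2 u v w z hn ?_
    exact (d1 _ _ _ _ (hD.transitivity hu (d1 _ _ _ _ (d1 _ _ _ _ (d1 _ _ _ _ hv).2).1).2)).2
  have k₁ : ∀ {x y z}, x < y → y < z → ¬ D (a y) (a z) (a x) (b j) := by
    intro x y z hxy hyz h
    refine key i i₂ i₃ i₄ (by simp; grind) ?_ ?_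
    · exact (hab.three j hxy hyz (h₁.trans h₂) h₃).2.2.1 h
    · exact (hab.three j hxy hyz h₂ h₃).2.2.1 h
  have k₂ : ∀ {x y z}, x < y → y < z → ¬ D (a x) (a z) (a y) (b j) := by
    intro x y z hxy hyz h
    refine key i₂ i₃ i i₄ (by simp; grind) ?_ ?_
    · exact (hab.three j hxy hyz h₁ (h₂.trans h₃)).2.1.1 h
    · exact (hab.three j hxy hyz (h₁.trans h₂) h₃).2.1.1 h
  have k₃ : ∀ {x y z}, x < y → y < z → ¬ D (a x) (a y) (a z) (b j) := by
    intro x y z hxy hyz h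
    refine key i₃ i₄ i i₂ (by simp; grind) ?_ ?_
    · exact (hab.three j hxy hyz h₁ h₂).1.1 h
    · exact (hab.three j hxy hyz h₁ (h₂.trans h₃)).1.1 h
  intro h
  rcases lt_or_gt_of_ne hik with o₁ | o₁ <;> rcases lt_or_gt_of_ne hil with o₂ | o₂ <;>
    rcases lt_or_gt_of_ne hkl with o₃ | o₃ <;> grind

theorem IsPetaled.exists_rel_of_mem_petaledHull (ha : IsPetaled D a) {x : Ω}
    (hx : x ∈ petaledHull D a) :
    ∃ i k l, i ≠ k ∧ i ≠ l ∧ k ≠ l ∧ D (a i) x (a k) (a l) := by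
  obtain ⟨C, ⟨hC, hsep⟩, S, hS, hxS, i, hi⟩ := hx
  obtain ⟨k, hk⟩ := exists_gt i
  obtain ⟨l, hl⟩ := exists_gt k
  exact ⟨i, k, l, hk.ne, (hk.trans hl).ne, hl.ne, hC.1.same S hS _ hi _ hxS _
    (fun h => ha.1.ne hk.ne (hsep S hS _ _ hi h)) _
    (fun h => ha.1.ne (hk.trans hl).ne (hsep S hS _ _ hi h))⟩

theorem IsPetaled.exists_rel_of_mem (hD : IsDSet D) (ha : IsPetaled D a)
    (hab : IsDUniformOver D a b) {x : Ω} (hx : x ∈ petaledHull D a) :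
    ∃ i k, i ≠ k ∧ ∀ j, D (a i) x (a k) (b j) := by
  obtain ⟨i, k, l, hik, hil, hkl, h⟩ := ha.exists_rel_of_mem_petaledHull hx
  refine ⟨i, k, hik, fun j => ?_⟩
  -- By (D3) the only alternative to the goal is `D(b_j x; a_k a_l)`, which with `h` would give the
  -- excluded `D(a_i b_j; a_k a_l)`.
  have := ha.not_rel hD hab hik hil hkl j
  have d1 := hD.d1
  have d2 := hD.d2
  have d3 := hD.d3
  grind

/-! ### Monotonic sequences -/

/-- Every term of `b` lies beyond one of the two ends of a monotonic sequence `a`. -/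
theorem IsMonotonic.rel_or_rel (hD : IsDSet D) (ha : IsMonotonic D a) (hab : IsDUniformOver D a b)
    (j : J) : (∀ i k l, i < k → k < l → D (a i) (a k) (a l) (b j)) ∨
      ∀ i k l, i < k → k < l → D (a k) (a l) (a i) (b j) := by
  by_contra! h
  obtain ⟨⟨x, y, z, hxy, hyz, h⟩, ⟨x', y', z', hxy', hyz', h'⟩⟩ := h
  obtain ⟨i₂, i₃, i₄, h₁, h₂, h₃⟩ := exists_lt_lt_lt x
  have k₁ : ∀ {x y z}, x < y → y < z → ¬ D (a x) (a y) (a z) (b j) :=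
    fun o o' e => h ((hab.three j o o' hxy hyz).1.1 e)
  have k₃ : ∀ {x y z}, x < y → y < z → ¬ D (a y) (a z) (a x) (b j) :=
    fun o o' e => h' ((hab.three j o o' hxy' hyz').2.2.1 e)
  -- Inserting `b_j` into `m` by (D3) yields a relation denied by `t₁` or one denied by `t₂`.
  have m := ha.2 _ _ _ _ h₁ h₂ h₃
  have t₁ := k₁ h₁ h₂
  have t₂ := k₃ h₂ h₃
  have d1 := hD.d1
  have d2 := hD.d2
  have d3 := hD.d3
  grind

/-- No term of `b` occurs in, or between the terms of, the sequence `a`. -/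
theorem IsMonotonic.rel (hD : IsDSet D) [LinearOrder J] (ha : IsMonotonic D a)
    (hab : IsDUniformOver D a b) (hba : IsDUniformOver D b a) :
    (∀ i k l, i < k → k < l → ∀ j, D (a i) (a k) (a l) (b j)) ∨
      ∀ i k l, i < k → k < l → ∀ j, D (a k) (a l) (a i) (b j) := by
  rcases isEmpty_or_nonempty J with hJ | ⟨⟨j⟩⟩
  · exact Or.inl fun i k l _ _ j => hJ.elim j
  · exact (ha.rel_or_rel hD hab j).imp
      (fun h i k l hik hkl j' => (hba.one _ _ _ _ _).1 (h i k l hik hkl))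
      (fun h i k l hik hkl j' => (hba.one _ _ _ _ _).1 (h i k l hik hkl))

variable [NoMinOrder I]

/-- A further term of `a`, above or below the pair according to the end at which `b` lies, is on the
same side of the pair as every term of `b`; transitivity eliminates it. -/
theorem IsMonotonic.rel_separated (hD : IsDSet D) [LinearOrder J] (ha : IsMonotonic D a)
    (hab : IsDUniformOver D a b) (hba : IsDUniformOver D b a) {i k : I} (hik : i ≠ k) (j l : J) :
    D (a i) (a k) (b j) (b l) := by
  have d1 := hD.d1
  have key : ∀ {i k : I}, i < k → D (a i) (a k) (b j) (b l) := by
    intro i k hik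
    obtain ⟨x, hx⟩ := exists_lt i
    obtain ⟨y, hy⟩ := exists_gt k
    rcases ha.rel hD hab hba with h | h
    · exact hD.transitivity (d1 _ _ _ _ (d1 _ _ _ _ (d1 _ _ _ _ (h _ _ _ hik hy j)).2).1).2
        (h _ _ _ hik hy l)
    · exact hD.transitivity (d1 _ _ _ _ (d1 _ _ _ _ (d1 _ _ _ _ (h _ _ _ hx hik j)).2).1).2
        (h _ _ _ hx hik l)
  rcases lt_or_gt_of_ne hik with h | h
  · exact key h
  · exact (d1 _ _ _ _ (key h)).1

theorem IsMonotonic.exists_rel_of_mem (hD : IsDSet D) [LinearOrder J] (ha : IsMonotonic D a)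
    (hab : IsDUniformOver D a b) (hba : IsDUniformOver D b a) {x : Ω}
    (hx : x ∈ Set.range a ∪ monotonicHull₁ D a ∪ monotonicHull₂ D a ∪ monotonicHull₃ D a) :
    ∃ i k, i ≠ k ∧ ∀ j, D (a i) x (a k) (b j) := by
  have d1 := hD.d1
  have d2 := hD.d2
  have d3 := hD.d3
  have d4 := hD.d4
  rcases hx with ((⟨i, rfl⟩ | ⟨i, k, l, hik, hkl, h⟩) | ⟨i, k, l, hik, hkl, h₁, h₂, h₃⟩) |
    ⟨i, j, k, l, hij, hjk, hkl, h₁, h₂⟩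
  · obtain ⟨k, hk⟩ := exists_gt i
    obtain ⟨l, hl⟩ := exists_gt k
    obtain ⟨y, hy⟩ := exists_lt i
    have hne := ha.1.ne hk.ne'
    refine ⟨i, k, hk.ne, fun j => (d1 _ _ _ _ (d4 (a k) (b j) (a i) hne ?_)).2⟩
    -- If `b_j = a_i`, then `a_i` would occur on both sides of a relation with two other distinct
    -- terms, against (D2) and (D4).
    intro e
    rcases ha.rel hD hab hba with h | h
    · have := h i k l hk hl j
      have := ha.1.ne hl.ne
      have := ha.1.ne (hk.trans hl).ne
      grind
    · have := h y i k hy hk j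
      have := ha.1.ne hy.ne
      have := ha.1.ne (hy.trans hk).ne
      grind
  -- For `H₁` and `H₂`, `x` branches off at the node of the three terms or on the arm of the middle
  -- one, while `b` lies on the arm of an outer one. So `x` goes with the middle term against that
  -- outer term and `b`.
  · rcases ha.rel hD hab hba with h' | h'
    · refine ⟨k, l, hkl.ne, fun j => ?_⟩
      have := h' i k l hik hkl j
      grind
    · refine ⟨k, i, hik.ne', fun j => ?_⟩
      have := h' i k l hik hkl j
      grind
  · rcases ha.rel hD hab hba with h' | h'
    · refine ⟨k, l, hkl.ne, fun j => ?_⟩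
      have := h' i k l hik hkl j
      grind
    · refine ⟨k, i, hik.ne', fun j => ?_⟩
      have := h' i k l hik hkl j
      grind
  -- Each of the two relations defining `H₃` serves one end: `h₁` if `b` lies above, `h₂` if `b`
  -- lies below.
  · rcases ha.rel hD hab hba with h' | h'
    · refine ⟨i, k, (hij.trans hjk).ne, fun m => ?_⟩
      have := h' i k l (hij.trans hjk) hkl m
      grind
    · refine ⟨l, j, (hjk.trans hkl).ne', fun m => ?_⟩
      have := h' i j l hij (hjk.trans hkl) m
      grind

end

theorem discernibleHull₁_cases {Ω I : Type*} [LinearOrder I] {D : Ω → Ω → Ω → Ω → Prop}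
    {a : I → Ω} {x : Ω} (hx : x ∈ discernibleHull₁ D a) :
    (IsPetaled D a ∧ x ∈ petaledHull D a) ∨ (IsMonotonic D a ∧
      x ∈ Set.range a ∪ monotonicHull₁ D a ∪ monotonicHull₂ D a ∪ monotonicHull₃ D a) := by
  unfold discernibleHull₁ at hx
  split_ifs at hx with h₁ h₂ h₃
  · exact hx.elim
  · exact Or.inl ⟨h₂, hx⟩
  · exact Or.inr ⟨h₃, hx⟩
  · exact hx.elim

/-! ### Disjointness of hulls -/

section

variable {Ω I J : Type*} {D : Ω → Ω → Ω → Ω → Prop} {a : I → Ω} {b : J → Ω}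

/-- In the tree, one hypothesis puts `x` on the arm of `a_i` at the median of `a_i, a_k, b_j`, the
other on the arm of `b_j` at the median of `b_j, b_l, a_k`. Separation places these arms at opposite
ends. -/
theorem IsDSet.not_rel_of_separated (hD : IsDSet D)
    (hsep : ∀ i k, i ≠ k → ∀ j l, j ≠ l → D (a i) (a k) (b j) (b l)) {x : Ω}
    (hx : ∃ i k, i ≠ k ∧ ∀ j, D (a i) x (a k) (b j)) :
    ¬ ∃ j l, j ≠ l ∧ ∀ i, D (b j) x (b l) (a i) := by
  rintro ⟨j, l, hjl, hb⟩
  obtain ⟨i, k, hik, ha⟩ := hx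
  have h := hsep i k hik j l hjl
  have h₁ := ha j
  have h₂ := hb k
  have d1 := hD.d1
  have d2 := hD.d2
  have d3 := hD.d3
  grind

variable [LinearOrder I] [NoMaxOrder I] [LinearOrder J] [NoMaxOrder J]

theorem IsPetaled.disjoint_petaledHull (hD : IsDSet D) (ha : IsPetaled D a) (hb : IsPetaled D b)
    (hab : IsDUniformOver D a b) (hba : IsDUniformOver D b a) :
    Disjoint (petaledHull D a) (petaledHull D b) := by
  rw [Set.disjoint_left]
  intro x hxa hxb
  have d1 := hD.d1
  have d2 := hD.d2
  have d3 := hD.d3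
  by_cases hsep : ∀ i k, i ≠ k → ∀ j l, j ≠ l → D (a i) (a k) (b j) (b l)
  · exact hD.not_rel_of_separated hsep (ha.exists_rel_of_mem hD hab hxa)
      (hb.exists_rel_of_mem hD hba hxb)
  -- By uniformity in both directions, separation holds for all pairs or for none.
  have hsep' : ∀ i k, i ≠ k → ∀ j l, j ≠ l → ¬ D (a i) (a k) (b j) (b l) := by
    intro i k hik j l hjl h
    refine hsep fun i' k' hik' j' l' hjl' => ?_
    have e₁ : D (a i') (a k') (b j) (b l) := by
      rcases lt_or_gt_of_ne hik with o | o <;> rcases lt_or_gt_of_ne hik' with o' | o' <;>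
        grind [hab.two j l o o']
    rcases lt_or_gt_of_ne hjl with o | o <;> rcases lt_or_gt_of_ne hjl' with o' | o' <;>
      grind [hba.two i' k' o o']
  obtain ⟨i, k, l, hik, hil, hkl, h⟩ := ha.exists_rel_of_mem_petaledHull hxa
  obtain ⟨i', k', l', hik', hil', hkl', h'⟩ := hb.exists_rel_of_mem_petaledHull hxb
  have n₁ := ha.not_rel hD hab hik hil hkl
  have n₂ := hb.not_rel hD hba hik' hil' hkl'
  have f₁ : ∀ j, D (a i) x (a k) (b j) := fun j => by
    have := n₁ j
    grind
  have f₂ : ∀ j, D (b i') x (b k') (a j) := fun j => by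
    have := n₂ j
    grind
  -- Here `a_i` is itself the partner of `x` against two terms of `b`, which (D2) forbids alongside
  -- `D(b_i' x; b_k' a_i)`.
  have e₁ : D (a i) x (b i') (b k') :=
    hD.transitivity (d1 _ _ _ _ (d1 _ _ _ _ (d1 _ _ _ _ (f₁ i')).2).1).2 (f₁ k')
  have e₂ := f₂ i
  grind

variable [NoMinOrder I] [NoMinOrder J]

theorem disjoint_discernibleHull₁ (hD : IsDSet D) (hab : IsDUniformOver D a b)
    (hba : IsDUniformOver D b a) :
    Disjoint (discernibleHull₁ D a) (discernibleHull₁ D b) := by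
  rw [Set.disjoint_left]
  intro x hxa hxb
  have d1 := hD.d1
  rcases discernibleHull₁_cases hxa with ⟨ha, hxa⟩ | ⟨ha, hxa⟩ <;>
    rcases discernibleHull₁_cases hxb with ⟨hb, hxb⟩ | ⟨hb, hxb⟩
  · exact Set.disjoint_left.1 (ha.disjoint_petaledHull hD hb hab hba) hxa hxb
  · exact hD.not_rel_of_separated
      (fun i k _ j l hjl => (d1 _ _ _ _ (hb.rel_separated hD hba hab hjl i k)).2)
      (ha.exists_rel_of_mem hD hab hxa) (hb.exists_rel_of_mem hD hba hab hxb)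
  · exact hD.not_rel_of_separated (fun i k hik j l _ => ha.rel_separated hD hab hba hik j l)
      (ha.exists_rel_of_mem hD hab hba hxa) (hb.exists_rel_of_mem hD hba hxb)
  · exact hD.not_rel_of_separated (fun i k hik j l _ => ha.rel_separated hD hab hba hik j l)
      (ha.exists_rel_of_mem hD hab hba hxa) (hb.exists_rel_of_mem hD hba hab hxb)

end

theorem mainTheorem9 (k : ℕ) (Ω : Type*) [(dLanguage k).Structure Ω]
    (hΩ : IsPureOrColoredDSet k Ω)
    (I J : Type*) [LinearOrder I] [NoMinOrder I] [NoMaxOrder I]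
    [LinearOrder J] [NoMinOrder J] [NoMaxOrder J]
    (n m : ℕ) (s : I → Fin n → Ω) (t : J → Fin m → Ω)
    (hs : IsIndiscernible (dLanguage k) s) (ht : IsIndiscernible (dLanguage k) t)
    (hst : AreMutuallyIndiscernible (dLanguage k) s t) :
    Disjoint (discernibleHull (dRel k Ω) s) (discernibleHull (dRel k Ω) t) := by
  simp only [discernibleHull, Set.disjoint_iUnion_left, Set.disjoint_iUnion_right]
  exact fun p q => disjoint_discernibleHull₁ hΩ.1 (hst.1.isDUniformOver _ _)
    (hst.2.isDUniformOver _ _)
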